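/- For a finite set $F\subseteq\mathbb{Z}$ let $\ell^2(\mathbb{N})^{\otimes F}$ denote the Hilbert space tensor product of copies of $\ell^2(\mathbb{N})$ indexed by the sites of $F$ (so $\ell^2(\mathbb{N})^{\otimes\varnothing}=\mathbb{C}$), and let $\mathcal{B}(\ell^2(\mathbb{N})^{\otimes F})$ be the algebra of all bounded operators on it. For finite sets $F\subseteq F'$, the unital injective $*$-homomorphism $a\mapsto a\otimes 1_{F'\setminus F}$ embeds $\mathcal{B}(\ell^2(\mathbb{N})^{\otimes F})$ into $\mathcal{B}(\ell^2(\mathbb{N})^{\otimes F'})$. Let $$\mathcal{L}^{\infty}:=\operatorname{colim}_{I}\,\mathcal{B}(\ell^2(\mathbb{N})^{\otimes I})$$ be the C*-algebraic colimit (the norm completion of the algebraic direct limit) over the bounded, possibly empty intervals $I\subseteq\mathbb{Z}$, ordered by inclusion. For a finite set $F\subseteq\mathbb{Z}$ let $\mathcal{L}^{\infty}_F\subseteq\mathcal{L}^{\infty}$ be the image of $\mathcal{B}(\ell^2(\mathbb{N})^{\otimes F})$ under $a\mapsto a\otimes 1_{I\setminus F}\in\mathcal{B}(\ell^2(\mathbb{N})^{\otimes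 I})\to\mathcal{L}^{\infty}$, where $I$ is any bounded interval containing $F$ (the image does not depend on $I$). For the complement $F^c=\mathbb{Z}\setminus F$ of a finite set $F$ let $\mathcal{L}^{\infty}_{F^c}$ be the C*-subalgebra of $\mathcal{L}^{\infty}$ generated by all $\mathcal{L}^{\infty}_I$ with $I\subseteq F^c$ a bounded interval. Theorem (strong algebraic Haag duality). For every finite subset $F\subseteq\mathbb{Z}$, $$\{x\in\mathcal{L}^{\infty} : xy-yx=0\ \text{ for all } y\in\mathcal{L}^{\infty}_{F^c}\}=\mathcal{L}^{\infty}_F .$$ -/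

import Mathlib

noncomputable section

/-! ### Amplification `a ↦ a ⊗ 1` on `ℓ²`

For a splitting `e : Y ≃ X × Z` of an index set, `ℓ²(Y) ≅ ℓ²(X) ⊗ ℓ²(Z)`, and
`amplify e a` is the operator `a ⊗ 1` on `ℓ²(Y)`. -/

namespace Amplification

/-- The Hilbert space `ℓ²(X)` with complex coefficients. -/
abbrev L2 (X : Type) : Type := lp (fun _ : X => ℂ) 2

variable {X Y Z : Type}

lemma memlp_two_iff {f : X → ℂ} : Memℓp f 2 ↔ Summable fun x => ‖f x‖ ^ 2 := by
  rw [memℓp_gen_iff (by norm_num)]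
  simp

lemma summable_sq (ξ : L2 X) : Summable fun x => ‖ξ x‖ ^ 2 :=
  memlp_two_iff.1 (lp.memℓp ξ)

lemma norm_sq_eq (ξ : L2 X) : ‖ξ‖ ^ 2 = ∑' x, ‖ξ x‖ ^ 2 := by
  have := lp.norm_rpow_eq_tsum (p := 2) (by norm_num) ξ
  simpa using this

/-- The slice `x ↦ ξ (x, z)` of a vector `ξ ∈ ℓ²(X × Z)`. -/
def slice (e : Y ≃ X × Z) (ξ : L2 Y) (z : Z) : L2 X :=
  ⟨fun x => ξ (e.symm (x, z)), memlp_two_iff.2 <|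
    (summable_sq ξ).comp_injective (i := fun x => e.symm (x, z)) fun x x' h => by
      simpa using h⟩

@[simp] lemma slice_apply (e : Y ≃ X × Z) (ξ : L2 Y) (z : Z) (x : X) :
    slice e ξ z x = ξ (e.symm (x, z)) := rfl

lemma summable_prod (e : Y ≃ X × Z) (ξ : L2 Y) :
    Summable fun p : Z × X => ‖ξ (e.symm (p.2, p.1))‖ ^ 2 :=
  (summable_sq ξ).comp_injective (i := fun p : Z × X => e.symm (p.2, p.1)) fun p p' h => by
    have := e.symm.injective h
    ext <;> simp_all

lemma summable_slice (e : Y ≃ X × Z) (ξ : L2 Y) : Summable fun z => ‖slice e ξ z‖ ^ 2 := by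
  simpa [norm_sq_eq] using (summable_prod e ξ).prod

lemma norm_sq_slice (e : Y ≃ X × Z) (ξ : L2 Y) : ‖ξ‖ ^ 2 = ∑' z, ‖slice e ξ z‖ ^ 2 := by
  simp only [norm_sq_eq, slice_apply]
  rw [← (summable_prod e ξ).tsum_prod]
  exact (((Equiv.prodComm Z X).trans e.symm).tsum_eq (fun y => ‖ξ y‖ ^ 2)).symm

lemma summable_family (g : Z → L2 X) (hg : Summable fun z => ‖g z‖ ^ 2) :
    Summable fun p : Z × X => ‖g p.1 p.2‖ ^ 2 := by
  have h0 : 0 ≤ fun p : Z × X => ‖g p.1 p.2‖ ^ 2 := fun p => pow_nonneg (norm_nonneg _) 2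
  refine (summable_prod_of_nonneg h0).2 ⟨fun z => summable_sq (g z), ?_⟩
  simpa only [← norm_sq_eq] using hg

/-- The vector of `ℓ²(X × Z)` with prescribed slices. -/
def ofSlices (e : Y ≃ X × Z) (g : Z → L2 X) (hg : Summable fun z => ‖g z‖ ^ 2) : L2 Y :=
  ⟨fun y => g (e y).2 (e y).1, memlp_two_iff.2 <|
    (e.trans (Equiv.prodComm X Z)).summable_iff.2 (summable_family g hg)⟩

lemma slice_ofSlices (e : Y ≃ X × Z) (g : Z → L2 X) (hg : Summable fun z => ‖g z‖ ^ 2) (z : Z) :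
    slice e (ofSlices e g hg) z = g z := by
  ext x; simp [ofSlices]

lemma summable_amplify (e : Y ≃ X × Z) (a : L2 X →L[ℂ] L2 X) (ξ : L2 Y) :
    Summable fun z => ‖a (slice e ξ z)‖ ^ 2 := by
  refine Summable.of_nonneg_of_le (fun _ => pow_nonneg (norm_nonneg _) 2) (fun z => ?_)
    ((summable_slice e ξ).mul_left (‖a‖ ^ 2))
  rw [← mul_pow]
  exact pow_le_pow_left₀ (norm_nonneg _) (a.le_opNorm _) 2

/-- The vector `(a ⊗ 1) ξ`, i.e. `a` applied to every slice of `ξ`. -/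
def amplifyVec (e : Y ≃ X × Z) (a : L2 X →L[ℂ] L2 X) (ξ : L2 Y) : L2 Y :=
  ofSlices e (fun z => a (slice e ξ z)) (summable_amplify e a ξ)

@[simp] lemma amplifyVec_apply (e : Y ≃ X × Z) (a : L2 X →L[ℂ] L2 X) (ξ : L2 Y) (y : Y) :
    amplifyVec e a ξ y = a (slice e ξ (e y).2) (e y).1 := rfl

@[simp] lemma slice_amplifyVec (e : Y ≃ X × Z) (a : L2 X →L[ℂ] L2 X) (ξ : L2 Y) (z : Z) :
    slice e (amplifyVec e a ξ) z = a (slice e ξ z) := by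
  ext x; simp

lemma norm_amplifyVec_le (e : Y ≃ X × Z) (a : L2 X →L[ℂ] L2 X) (ξ : L2 Y) :
    ‖amplifyVec e a ξ‖ ≤ ‖a‖ * ‖ξ‖ := by
  refine le_of_sq_le_sq ?_ (by positivity)
  rw [mul_pow, norm_sq_slice e, norm_sq_slice e ξ, ← tsum_mul_left]
  refine (summable_slice e _).tsum_le_tsum (fun z => ?_) ((summable_slice e ξ).mul_left _)
  rw [slice_amplifyVec, ← mul_pow]
  exact pow_le_pow_left₀ (norm_nonneg _) (a.le_opNorm _) 2

lemma slice_add (e : Y ≃ X × Z) (ξ η : L2 Y) (z : Z) :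
    slice e (ξ + η) z = slice e ξ z + slice e η z := by ext; simp

lemma slice_smul (e : Y ≃ X × Z) (c : ℂ) (ξ : L2 Y) (z : Z) :
    slice e (c • ξ) z = c • slice e ξ z := by ext; simp

/-- The bounded operator `a ⊗ 1` on `ℓ²(Y) ≅ ℓ²(X) ⊗ ℓ²(Z)`. -/
def amplifyCLM (e : Y ≃ X × Z) (a : L2 X →L[ℂ] L2 X) : L2 Y →L[ℂ] L2 Y :=
  LinearMap.mkContinuous
    { toFun := amplifyVec e a
      map_add' := fun ξ η => by ext; simp [slice_add]
      map_smul' := fun c ξ => by ext; simp [slice_smul] }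
    ‖a‖ (norm_amplifyVec_le e a)

@[simp] lemma amplifyCLM_apply (e : Y ≃ X × Z) (a : L2 X →L[ℂ] L2 X) (ξ : L2 Y) (y : Y) :
    amplifyCLM e a ξ y = a (slice e ξ (e y).2) (e y).1 := rfl

@[simp] lemma slice_amplifyCLM (e : Y ≃ X × Z) (a : L2 X →L[ℂ] L2 X) (ξ : L2 Y) (z : Z) :
    slice e (amplifyCLM e a ξ) z = a (slice e ξ z) :=
  slice_amplifyVec e a ξ z

lemma inner_slice (e : Y ≃ X × Z) (ξ η : L2 Y) :
    inner ℂ ξ η = ∑' z, inner ℂ (slice e ξ z) (slice e η z) := by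
  simp only [lp.inner_eq_tsum, slice_apply]
  have hs : Summable fun p : Z × X =>
      inner ℂ (ξ (e.symm (p.2, p.1))) (η (e.symm (p.2, p.1))) :=
    ((Equiv.prodComm Z X).trans e.symm).summable_iff.2 (lp.summable_inner (𝕜 := ℂ) ξ η)
  rw [← hs.tsum_prod]
  exact (((Equiv.prodComm Z X).trans e.symm).tsum_eq (fun y => inner ℂ (ξ y) (η y))).symm

/-- The unital `*`-homomorphism `a ↦ a ⊗ 1` from `B(ℓ²(X))` to
`B(ℓ²(Y)) ≅ B(ℓ²(X) ⊗ ℓ²(Z))`. -/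
def amplify (e : Y ≃ X × Z) : (L2 X →L[ℂ] L2 X) →⋆ₐ[ℂ] (L2 Y →L[ℂ] L2 Y) where
  toFun := amplifyCLM e
  map_one' := by ext; simp
  map_mul' a b := by ext; simp
  map_zero' := by ext; simp
  map_add' a b := by ext; simp
  commutes' c := by ext; simp [Algebra.algebraMap_eq_smul_one]
  map_star' a := by
    rw [ContinuousLinearMap.star_eq_adjoint (amplifyCLM e a), ContinuousLinearMap.eq_adjoint_iff]
    intro ξ η
    rw [inner_slice e, inner_slice e]
    simp [ContinuousLinearMap.star_eq_adjoint, ContinuousLinearMap.adjoint_inner_left]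

@[simp] lemma amplify_apply (e : Y ≃ X × Z) (a : L2 X →L[ℂ] L2 X) (ξ : L2 Y) (y : Y) :
    amplify e a ξ y = a (slice e ξ (e y).2) (e y).1 := rfl

/-- `(a ⊗ 1)(u ⊗ v) = (a u) ⊗ v`, written out in coordinates. -/
lemma amplify_tensor (e : Y ≃ X × Z) (a : L2 X →L[ℂ] L2 X) (u : L2 X) (v : L2 Z) (ξ : L2 Y)
    (hξ : ∀ y, ξ y = u (e y).1 * v (e y).2) (y : Y) :
    amplify e a ξ y = (a u) (e y).1 * v (e y).2 := by
  have : slice e ξ (e y).2 = v (e y).2 • u := by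
    ext x; simp [hξ, mul_comm]
  simp [this, mul_comm]

lemma amplify_injective (e : Y ≃ X × Z) [Nonempty Z] : Function.Injective (amplify e) := by
  classical
  intro a b hab
  obtain ⟨z⟩ := ‹Nonempty Z›
  ext u x
  have hg : Summable fun z' => ‖(if z' = z then u else 0 : L2 X)‖ ^ 2 :=
    summable_of_ne_finset_zero (s := {z}) fun z' hz' => by simp_all
  let ξ : L2 Y := ofSlices e (fun z' => if z' = z then u else 0) hg
  have hs : slice e ξ z = u := by simp [ξ, slice_ofSlices]
  have := congrArg (fun T => slice e (T ξ) z) hab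
  have h2 : ∀ c, slice e (amplify e c ξ) z = c u := fun c => by
    rw [← hs]; exact slice_amplifyCLM e c ξ z
  simp only [h2] at this
  rw [this]

end Amplification

/-! ### The C*-algebraic colimit of a directed system

For a directed system of unital C*-algebras with isometric (equivalently, injective) unital
connecting `*`-homomorphisms, the algebraic direct limit carries a canonical C*-norm, and the
colimit in the category of C*-algebras is its completion. -/

namespace CStarColimit

open UniformSpace

set_option linter.unusedSectionVars false

variable {ι : Type} [Preorder ι] [IsDirectedOrder ι] [Nonempty ι]
variable (G : ι → Type) [∀ i, CStarAlgebra (G i)]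
variable (f : ∀ i j, i ≤ j → G i →⋆ₐ[ℂ] G j) [DirectedSystem G (f · · ·)]

/-- All connecting maps of the system are isometric. -/
class IsometricSystem : Prop where
  norm_map : ∀ i j (h : i ≤ j) (x : G i), ‖f i j h x‖ = ‖x‖

variable [IsometricSystem G f]

/-- The algebraic direct limit of the system. -/
abbrev Alg : Type := DirectLimit G f

instance instNorm : Norm (Alg G f) where
  norm := DirectLimit.lift f (fun _ x => ‖x‖)
    fun i j h x => (IsometricSystem.norm_map (f := f) i j h x).symm

lemma norm_mk (i : ι) (x : G i) : ‖(⟦⟨i, x⟩⟧ : Alg G f)‖ = ‖x‖ := rfl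

instance instNormedAddCommGroup : NormedAddCommGroup (Alg G f) :=
  AddGroupNorm.toNormedAddCommGroup
    { toFun := fun x => ‖x‖
      map_zero' := by
        obtain ⟨i⟩ := ‹Nonempty ι›
        rw [DirectLimit.zero_def i, norm_mk, norm_zero]
      add_le' := DirectLimit.induction₂ _ fun i x y => by
        rw [DirectLimit.add_def, norm_mk, norm_mk, norm_mk]
        exact norm_add_le x y
      neg' := DirectLimit.induction _ fun i x => by
        rw [DirectLimit.neg_def, norm_mk, norm_mk, norm_neg]
      eq_zero_of_map_eq_zero' := DirectLimit.induction _ fun i x hx => by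
        rw [norm_mk, norm_eq_zero] at hx
        rw [hx, ← DirectLimit.zero_def i] }

instance instNormedRing : NormedRing (Alg G f) where
  __ := instNormedAddCommGroup G f
  __ := (inferInstance : Ring (Alg G f))
  norm_mul_le := DirectLimit.induction₂ _ fun i x y => by
    rw [DirectLimit.mul_def, norm_mk, norm_mk, norm_mk]
    exact norm_mul_le x y

instance instNormedAlgebra : NormedAlgebra ℂ (Alg G f) where
  norm_smul_le c := DirectLimit.induction _ fun i x => by
    rw [DirectLimit.smul_def, norm_mk, norm_mk]
    exact norm_smul_le c x

instance instStarRing : StarRing (Alg G f) where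
  star_add := star_add

instance instCStarRing : CStarRing (Alg G f) where
  norm_mul_self_le := DirectLimit.induction _ fun i x => by
    rw [DirectLimit.star_def, DirectLimit.mul_def, norm_mk, norm_mk]
    exact CStarRing.norm_mul_self_le x

/-- The C*-algebraic colimit: the completion of the algebraic direct limit. -/
def Colim : Type := Completion (Alg G f)

instance : NormedRing (Colim G f) := inferInstanceAs (NormedRing (Completion (Alg G f)))
instance : CompleteSpace (Colim G f) := inferInstanceAs (CompleteSpace (Completion (Alg G f)))
instance : Algebra ℂ (Colim G f) := inferInstanceAs (Algebra ℂ (Completion (Alg G f)))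

instance : NormedAlgebra ℂ (Colim G f) where
  norm_smul_le := norm_smul_le (β := Completion (Alg G f))

/-- The canonical map from the algebraic direct limit to its completion. -/
def coe (x : Alg G f) : Colim G f := (x : Completion (Alg G f))

/-- The star operation is the continuous extension of the one on the direct limit. -/
instance : Star (Colim G f) where
  star := Completion.map (star : Alg G f → Alg G f)

lemma uniformContinuous_star' : UniformContinuous (star : Alg G f → Alg G f) :=
  (starNormedAddGroupHom : NormedAddGroupHom (Alg G f) (Alg G f)).uniformContinuous

lemma coe_star (x : Alg G f) : coe G f (star x) = star (coe G f x) :=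
  (Completion.map_coe (uniformContinuous_star' G f) x).symm

lemma continuous_star' : Continuous (star : Colim G f → Colim G f) :=
  Completion.continuous_map

lemma colim_induction {p : Colim G f → Prop} (x : Colim G f) (hp : IsClosed {x | p x})
    (ih : ∀ x, p (coe G f x)) : p x :=
  Completion.induction_on x hp ih

lemma colim_induction₂ {p : Colim G f → Colim G f → Prop} (x y : Colim G f)
    (hp : IsClosed {x : Colim G f × Colim G f | p x.1 x.2})
    (ih : ∀ x y, p (coe G f x) (coe G f y)) : p x y :=
  Completion.induction_on₂ x y hp ih

lemma coe_add (x y : Alg G f) : coe G f (x + y) = coe G f x + coe G f y :=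
  Completion.coe_add x y

lemma coe_mul (x y : Alg G f) : coe G f (x * y) = coe G f x * coe G f y :=
  Completion.coe_mul x y

lemma coe_smul (c : ℂ) (x : Alg G f) : coe G f (c • x) = c • coe G f x :=
  Completion.coe_smul c x

lemma norm_coe (x : Alg G f) : ‖coe G f x‖ = ‖x‖ :=
  Completion.norm_coe x

instance : StarRing (Colim G f) where
  star_involutive x := by
    have hc := continuous_star' G f
    refine colim_induction G f (p := fun x => star (star x) = x) x
      (isClosed_eq (hc.comp hc) continuous_id) fun x => ?_
    rw [← coe_star, ← coe_star, star_star]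
  star_mul x y := by
    have hc := continuous_star' G f
    refine colim_induction₂ G f (p := fun x y => star (x * y) = star y * star x) x y
      (isClosed_eq (hc.comp continuous_mul)
        ((hc.comp continuous_snd).mul (hc.comp continuous_fst))) fun x y => ?_
    rw [← coe_mul, ← coe_star, ← coe_star, ← coe_star, ← coe_mul, star_mul]
  star_add x y := by
    have hc := continuous_star' G f
    refine colim_induction₂ G f (p := fun x y => star (x + y) = star x + star y) x y
      (isClosed_eq (hc.comp continuous_add)
        ((hc.comp continuous_fst).add (hc.comp continuous_snd))) fun x y => ?_
    rw [← coe_add, ← coe_star, ← coe_star, ← coe_star, ← coe_add, star_add]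

instance : CStarRing (Colim G f) where
  norm_mul_self_le x := by
    have hc := continuous_star' G f
    refine colim_induction G f (p := fun x => ‖x‖ * ‖x‖ ≤ ‖star x * x‖) x
      (isClosed_le (continuous_norm.mul continuous_norm)
        ((hc.mul continuous_id).norm)) fun x => ?_
    rw [← coe_star, ← coe_mul, norm_coe, norm_coe]
    exact CStarRing.norm_mul_self_le x

instance : StarModule ℂ (Colim G f) where
  star_smul c x := by
    have hc := continuous_star' G f
    refine colim_induction G f (p := fun x => star (c • x) = star c • star x) x
      (isClosed_eq (hc.comp (continuous_const_smul c)) (hc.const_smul (star c))) fun x => ?_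
    rw [← coe_smul, ← coe_star, ← coe_star, ← coe_smul, star_smul]

instance : CStarAlgebra (Colim G f) where

/-- The canonical `*`-homomorphism from a member of the system to the colimit. -/
def of (i : ι) : G i →⋆ₐ[ℂ] Colim G f where
  toFun x := coe G f ⟦⟨i, x⟩⟧
  map_one' := by rw [← DirectLimit.one_def i]; rfl
  map_zero' := by rw [← DirectLimit.zero_def i]; rfl
  map_mul' x y := by rw [← DirectLimit.mul_def, coe_mul]
  map_add' x y := by rw [← DirectLimit.add_def, coe_add]
  commutes' c := by rw [← DirectLimit.algebraMap_def i]; rfl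
  map_star' x := by rw [← DirectLimit.star_def, coe_star]

lemma of_map (i j : ι) (h : i ≤ j) (x : G i) : of G f j (f i j h x) = of G f i x :=
  congrArg (coe G f) (DirectLimit.mk_apply i j x h)

lemma norm_of (i : ι) (x : G i) : ‖of G f i x‖ = ‖x‖ :=
  (norm_coe G f _).trans (norm_mk G f i x)

lemma dense_iUnion_range_of : Dense (⋃ i, Set.range (of G f i)) := by
  have h : DenseRange (coe G f) := Completion.denseRange_coe
  refine Dense.mono ?_ h
  rintro _ ⟨x, rfl⟩
  induction x using DirectLimit.induction with
  | _ i x => exact Set.mem_iUnion.2 ⟨i, x, rfl⟩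

end CStarColimit

/-! ### The quasi-local algebra `𝓛^∞` over `ℤ` -/

namespace QuasiLocal

open Amplification

/-- The Hilbert space tensor power `ℓ²(ℕ)^{⊗ F} = ℓ²(ℕ^F)`; the elementary tensor
`⊗_{k ∈ F} e_{n k}` of standard basis vectors is the basis vector of `ℓ²(ℕ^F)` at `n`. -/
abbrev Hilb (F : Finset ℤ) : Type := L2 (F → ℕ)

/-- `B(ℓ²(ℕ)^{⊗ F})`. -/
abbrev Op (F : Finset ℤ) : Type := Hilb F →L[ℂ] Hilb F

/-- For `F ⊆ F'`, the splitting `ℕ^{F'} ≃ ℕ^F × ℕ^{F' \ F}`. -/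
def split {F F' : Finset ℤ} (h : F ⊆ F') : (F' → ℕ) ≃ (F → ℕ) × (↥(F' \ F) → ℕ) where
  toFun n := (fun k => n ⟨k, h k.2⟩, fun k => n ⟨k, (Finset.mem_sdiff.1 k.2).1⟩)
  invFun p k := if hk : (k : ℤ) ∈ F then p.1 ⟨k, hk⟩
    else p.2 ⟨k, Finset.mem_sdiff.2 ⟨k.2, hk⟩⟩
  left_inv n := by
    funext k
    by_cases hk : (k : ℤ) ∈ F <;> simp [hk]
  right_inv p := by
    ext k
    · simp
    · have hk := (Finset.mem_sdiff.1 k.2).2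
      simp [hk]

/-- For `F ⊆ F'`, the inclusion `a ↦ a ⊗ 1` of `B(ℓ²(ℕ)^{⊗ F})` into `B(ℓ²(ℕ)^{⊗ F'})`. -/
def incl {F F' : Finset ℤ} (h : F ⊆ F') : Op F →⋆ₐ[ℂ] Op F' := amplify (split h)

lemma incl_self {F : Finset ℤ} (h : F ⊆ F) (a : Op F) : incl h a = a := by
  ext ξ n
  have h1 : slice (split h) ξ (split h n).2 = ξ := by
    ext m
    simp [split]
  simp only [incl, amplify_apply, h1]
  rfl

lemma incl_incl {F F' F'' : Finset ℤ} (h : F ⊆ F') (h' : F' ⊆ F'') (a : Op F) :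
    incl h' (incl h a) = incl (h.trans h') a := by
  ext ξ n
  have h1 : slice (split h) (slice (split h') ξ (split h' n).2) (split h (split h' n).1).2 =
      slice (split (h.trans h')) ξ (split (h.trans h') n).2 := by
    ext m
    simp only [slice_apply]
    refine congrArg (ξ : (F'' → ℕ) → ℂ) (funext fun k => ?_)
    by_cases hk : (k : ℤ) ∈ F
    · simp [split, hk, h hk]
    · by_cases hk' : (k : ℤ) ∈ F' <;> simp [split, hk, hk']
  simp only [incl, amplify_apply, h1]
  rfl

lemma incl_injective {F F' : Finset ℤ} (h : F ⊆ F') : Function.Injective (incl h) :=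
  amplify_injective _

/-- Bounded (possibly empty) intervals of `ℤ`, ordered by inclusion. -/
abbrev Intvl : Type := {I : Finset ℤ // (I : Set ℤ).OrdConnected}

/-- The smallest interval containing a finite set. -/
def hull (F : Finset ℤ) : Intvl :=
  if h : F.Nonempty then ⟨Finset.Icc (F.min' h) (F.max' h), by
    rw [Finset.coe_Icc]; exact Set.ordConnected_Icc⟩
  else ⟨∅, by rw [Finset.coe_empty]; exact Set.ordConnected_empty⟩

lemma subset_hull (F : Finset ℤ) : F ⊆ (hull F).1 := by
  intro k hk
  have h : F.Nonempty := ⟨k, hk⟩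
  simp only [hull, h, dif_pos, Finset.mem_Icc]
  exact ⟨F.min'_le k hk, F.le_max' k hk⟩

lemma hull_eq_self (I : Intvl) : hull I.1 = I := by
  refine Subtype.ext (Finset.Subset.antisymm ?_ (subset_hull _))
  by_cases h : I.1.Nonempty
  · simp only [hull, h, dif_pos]
    intro k hk
    exact I.2.out (I.1.min'_mem h) (I.1.max'_mem h) (Finset.mem_Icc.1 hk)
  · simp [hull, h]

instance : Nonempty Intvl := ⟨hull ∅⟩

instance : IsDirectedOrder Intvl where
  directed I J := ⟨hull (I.1 ∪ J.1),
    Finset.subset_union_left.trans (subset_hull _),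
    Finset.subset_union_right.trans (subset_hull _)⟩

/-- The local algebra `𝓛^∞_I = B(ℓ²(ℕ)^{⊗ I})` of an interval. -/
abbrev net (I : Intvl) : Type := Op I.1

/-- The connecting maps `a ↦ a ⊗ 1` of the net of local algebras. -/
abbrev netMap (I J : Intvl) (h : I ≤ J) : net I →⋆ₐ[ℂ] net J := incl h

instance : DirectedSystem net (netMap · · ·) where
  map_self _ a := incl_self _ a
  map_map _ _ _ h h' a := incl_incl h h' a

instance : CStarColimit.IsometricSystem net netMap where
  norm_map _ _ h a := NonUnitalStarAlgHom.norm_map (netMap _ _ h) (incl_injective h) a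

/-- The quasi-local C*-algebra `𝓛^∞ = colim_I B(ℓ²(ℕ)^{⊗ I})`, the C*-algebraic colimit over the
bounded intervals of `ℤ`. -/
abbrev LInf : Type := CStarColimit.Colim net netMap

/-- The local subalgebra `𝓛^∞_F ⊆ 𝓛^∞` of an arbitrary finite set `F ⊆ ℤ`: the image of
`B(ℓ²(ℕ)^{⊗ F})` under `a ↦ a ⊗ 1 ∈ B(ℓ²(ℕ)^{⊗ I})`, where `I` is the smallest interval
containing `F`. -/
def localAlg (F : Finset ℤ) : StarSubalgebra ℂ LInf :=
  ((CStarColimit.of net netMap (hull F)).comp (incl (subset_hull F))).range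

/-- Any interval containing `F` may be used in place of the smallest one. -/
lemma mem_localAlg_iff {F : Finset ℤ} {I : Intvl} (h : F ⊆ I.1) (x : LInf) :
    x ∈ localAlg F ↔ ∃ a : Op F, CStarColimit.of net netMap I (incl h a) = x := by
  have key : ∀ a : Op F, CStarColimit.of net netMap I (incl h a) =
      CStarColimit.of net netMap (hull F) (incl (subset_hull F) a) := by
    intro a
    obtain ⟨J, hJ, hJ'⟩ := exists_ge_ge I (hull F)
    rw [← CStarColimit.of_map net netMap I J hJ, ← CStarColimit.of_map net netMap (hull F) J hJ',
      netMap, netMap, incl_incl, incl_incl]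
  simp only [key]
  rfl

/-- The algebra `𝓛^∞_S` of a (possibly unbounded) region `S ⊆ ℤ`: the C*-subalgebra of `𝓛^∞`
generated by the local algebras of the bounded intervals contained in `S`. -/
def regionAlg (S : Set ℤ) : StarSubalgebra ℂ LInf :=
  (StarAlgebra.adjoin ℂ
    (⋃ (I : Intvl) (_ : (I.1 : Set ℤ) ⊆ S), (localAlg I.1 : Set LInf))).topologicalClosure

end QuasiLocal

end

/-! Operators with disjoint supports commute, which gives one inclusion. For the other, let `x`
commute with the algebra of the complement, and approximate it in norm by a local operator `a`
supported on some `K ⊇ F`. It suffices to push `a` down to `F` without increasing its distance to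
`x`: since `𝓛^∞_F` is closed, `x` then lies in it.

The support is reduced from `K` to `A ⊆ K` by a slice map `E(a) = (1 ⊗ ⟨0|) a (1 ⊗ |0⟩)`. With `v_m
= |m⟩⟨0|` on the sites `K \ A` and `P_S = ∑_{m ∈ S} |m⟩⟨m|`, one has `v_m a v_m* = E(a) v_m v_m*`,
and `v_m x v_m* = x v_m v_m*` because `x` commutes with `v_m`. Hence `(x - E(a)) P_S = ∑_{m ∈ S} v_m
(x - a) v_m*`, whose norm is at most `‖x - a‖` (`norm_sum_mul_mul_star_le`). As the `P_S` detect the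
norm (`norm_le_of_forall_norm_mul_toLInf_le`), `‖x - E(a)‖ ≤ ‖x - a‖`; this is
`exists_norm_sub_toLInf_le`.

The sites of `K \ F` are removed one at a time. `K \ F` may lie on both sides of a point of `F`, and
`B(H₁ ⊗ H₂)` is not norm-generated by `B(H₁)` and `B(H₂)` in infinite dimensions, so `x` is not
known at the outset to commute with all of `𝓛^∞_{K \ F}`. Single sites, however, are intervals. -/

noncomputable section

/-! ### Elementary tensors and commuting tensor factors -/

namespace Amplification

variable {X Y Z : Type}

/-- The splitting with the two factors interchanged. -/
abbrev flip (e : Y ≃ X × Z) : Y ≃ Z × X := e.trans (Equiv.prodComm X Z)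

/-- The elementary tensor `u ⊗ v` in `ℓ²(Y) ≅ ℓ²(X) ⊗ ℓ²(Z)`. -/
def tensor (e : Y ≃ X × Z) (u : L2 X) (v : L2 Z) : L2 Y :=
  ofSlices e (fun z => v z • u) <| by
    simpa [norm_smul, mul_pow] using (summable_sq v).mul_right (‖u‖ ^ 2)

@[simp] lemma tensor_apply (e : Y ≃ X × Z) (u : L2 X) (v : L2 Z) (y : Y) :
    tensor e u v y = u (e y).1 * v (e y).2 := mul_comm _ _

lemma amplify_tensor_eq (e : Y ≃ X × Z) (a : L2 X →L[ℂ] L2 X) (u : L2 X) (v : L2 Z) :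
    amplify e a (tensor e u v) = tensor e (a u) v := by
  ext y
  rw [amplify_tensor e a u v _ (tensor_apply e u v), tensor_apply]

lemma amplify_flip_tensor_eq (e : Y ≃ X × Z) (b : L2 Z →L[ℂ] L2 Z) (u : L2 X) (v : L2 Z) :
    amplify (flip e) b (tensor e u v) = tensor e u (b v) := by
  ext y
  rw [amplify_tensor (flip e) b v u _ fun y => by simp [mul_comm], tensor_apply]
  simp [mul_comm]

/-- Reduces identities between bounded operators on `ℓ²(Y)` to elementary tensors, since the basis
vectors have dense span. -/
lemma single_eq_tensor [DecidableEq X] [DecidableEq Y] [DecidableEq Z] (e : Y ≃ X × Z) (y : Y)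
    (c : ℂ) : (lp.single 2 y c : L2 Y) = tensor e (lp.single 2 (e y).1 c) (lp.single 2 (e y).2 1) := by
  ext y'
  by_cases h : y' = y
  · subst h; simp
  · have h' : (e y').1 ≠ (e y).1 ∨ (e y').2 ≠ (e y).2 := by
      by_contra! h'
      exact h (e.injective (Prod.ext h'.1 h'.2))
    rcases h' with h' | h' <;> simp [h', lp.single_apply, Pi.single_apply, h]

/-- `a ⊗ 1` and `1 ⊗ b` commute. -/
lemma commute_amplify_flip (e : Y ≃ X × Z) (a : L2 X →L[ℂ] L2 X) (b : L2 Z →L[ℂ] L2 Z) :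
    Commute (amplify e a) (amplify (flip e) b) := by
  classical
  refine lp.ext_continuousLinearMap (by simp) fun y => ?_
  ext1
  simp only [ContinuousLinearMap.comp_apply, lp.singleContinuousLinearMap_apply,
    mul_apply_eq_comp]
  rw [single_eq_tensor e, amplify_flip_tensor_eq, amplify_tensor_eq, amplify_tensor_eq,
    amplify_flip_tensor_eq]

/-! ### Matrix units and slice maps -/

/-- The matrix unit `|m⟩⟨n|` on `ℓ²(Z)`. -/
def matrixUnit [DecidableEq Z] (m n : Z) : L2 Z →L[ℂ] L2 Z :=
  (lp.evalCLM ℂ (fun _ : Z => ℂ) 2 n).smulRight (lp.single 2 m (1 : ℂ))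

/-- The slice `ξ ↦ (x ↦ ξ (x, z))` as a bounded operator. -/
def sliceCLM (e : Y ≃ X × Z) (z : Z) : L2 Y →L[ℂ] L2 X :=
  LinearMap.mkContinuous
    { toFun := fun ξ => slice e ξ z
      map_add' := fun ξ η => slice_add e ξ η z
      map_smul' := fun c ξ => slice_smul e c ξ z } 1 fun ξ => by
    refine le_of_sq_le_sq ?_ (by positivity)
    rw [one_mul, norm_sq_slice e ξ]
    exact (summable_slice e ξ).le_tsum z fun _ _ => by positivity

lemma sliceCLM_apply (e : Y ≃ X × Z) (z : Z) (ξ : L2 Y) : sliceCLM e z ξ = slice e ξ z := rfl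

section MatrixUnit

variable [DecidableEq Z]

lemma matrixUnit_apply (m n : Z) (ξ : L2 Z) :
    matrixUnit m n ξ = ξ n • (lp.single 2 m (1 : ℂ) : L2 Z) := rfl

@[simp] lemma matrixUnit_apply_apply (m n : Z) (ξ : L2 Z) (z : Z) :
    matrixUnit m n ξ z = if z = m then ξ n else 0 := by
  simp [matrixUnit_apply, lp.single_apply, Pi.single_apply]

lemma matrixUnit_mul (m n k l : Z) :
    matrixUnit m n * matrixUnit k l = if n = k then matrixUnit m l else 0 := by
  ext ξ z
  by_cases h : n = k <;> simp [h]

lemma star_matrixUnit (m n : Z) : star (matrixUnit m n) = matrixUnit n m := by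
  symm
  rw [ContinuousLinearMap.star_eq_adjoint, ContinuousLinearMap.eq_adjoint_iff]
  intro ξ η
  simp [matrixUnit_apply, inner_smul_left, inner_smul_right, lp.inner_single_left,
    lp.inner_single_right, mul_comm]

lemma sum_matrixUnit_apply (S : Finset Z) (ξ : L2 Z) (z : Z) :
    (∑ m ∈ S, matrixUnit m m) ξ z = if z ∈ S then ξ z else 0 := by
  rw [sum_apply, lp.coeFn_sum, Finset.sum_apply]
  simp

lemma isStarProjection_sum_matrixUnit (S : Finset Z) :
    IsStarProjection (∑ m ∈ S, matrixUnit m m) where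
  isIdempotentElem := by
    ext ξ z
    rw [mul_apply_eq_comp, sum_matrixUnit_apply, sum_matrixUnit_apply]
    split_ifs <;> rfl
  isSelfAdjoint := by simp [IsSelfAdjoint, star_matrixUnit]

/-- The isometry `u ↦ u ⊗ |z⟩`. -/
def tensorBasis (e : Y ≃ X × Z) (z : Z) : L2 X →L[ℂ] L2 Y :=
  LinearMap.mkContinuous
    { toFun := fun u => tensor e u (lp.single 2 z 1)
      map_add' := fun u v => by ext; simp [add_mul]
      map_smul' := fun c u => by ext; simp [mul_assoc] } 1 fun u => by
    refine le_of_sq_le_sq ?_ (by positivity)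
    rw [norm_sq_slice e, one_mul, tsum_eq_single z]
    · refine le_of_eq (congrArg (‖·‖ ^ 2) ?_)
      ext x; simp
    · intro z' hz'
      have : slice e (tensor e u (lp.single 2 z 1)) z' = 0 := by
        ext x; simp [hz', lp.single_apply]
      simpa using this

lemma tensorBasis_apply (e : Y ≃ X × Z) (z : Z) (u : L2 X) :
    tensorBasis e z u = tensor e u (lp.single 2 z 1) := rfl

/-- The slice map `(1 ⊗ ⟨z|) a (1 ⊗ |z⟩)` of an operator on `ℓ²(X) ⊗ ℓ²(Z)`. -/
def compress (e : Y ≃ X × Z) (z : Z) (a : L2 Y →L[ℂ] L2 Y) : L2 X →L[ℂ] L2 X :=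
  sliceCLM e z ∘L a ∘L tensorBasis e z

/-- The sandwich moves the diagonal block of `a` at `z` to position `m`. The block itself does not
depend on `m`, so summing over `m` rebuilds a truncation of `compress e z a ⊗ 1`. -/
lemma matrixUnit_mul_mul_matrixUnit (e : Y ≃ X × Z) (m z : Z) (a : L2 Y →L[ℂ] L2 Y) :
    amplify (flip e) (matrixUnit m z) * a * amplify (flip e) (matrixUnit z m) =
      amplify e (compress e z a) * amplify (flip e) (matrixUnit m m) := by
  ext ξ y
  have h1 : amplify (flip e) (matrixUnit z m) ξ = tensorBasis e z (slice e ξ m) := by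
    ext y
    simp [tensorBasis_apply, lp.single_apply, Pi.single_apply]
  have h2 : slice e (amplify (flip e) (matrixUnit m m) ξ) (e y).2 =
      (if (e y).2 = m then (1 : ℂ) else 0) • slice e ξ m := by
    ext x
    by_cases h : (e y).2 = m <;> simp [h]
  rw [mul_apply_eq_comp, mul_apply_eq_comp, mul_apply_eq_comp,
    h1, amplify_apply, amplify_apply, h2, map_smul]
  by_cases h : (e y).2 = m <;> simp [h, compress, sliceCLM_apply]

/-- The projections `1 ⊗ ∑_{m ∈ S} |m⟩⟨m|` increase to `1`, so they detect the operator norm. -/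
lemma norm_le_of_forall_norm_mul_le (e : Y ≃ Z × X) (b : L2 Y →L[ℂ] L2 Y) {C : ℝ}
    (h : ∀ S : Finset Z, ‖b * amplify e (∑ m ∈ S, matrixUnit m m)‖ ≤ C) : ‖b‖ ≤ C := by
  classical
  have hC : 0 ≤ C := (norm_nonneg _).trans (h ∅)
  refine b.opNorm_le_bound hC fun ξ => ?_
  have hs := lp.hasSum_single (p := 2) (by simp) ξ
  refine le_of_tendsto_of_tendsto ((b.continuous.tendsto _).comp hs).norm
    (hs.norm.const_mul C) (Filter.Eventually.of_forall fun W => ?_)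
  set ζ : L2 Y := ∑ y ∈ W, lp.single 2 y (ξ y) with hζ
  -- A finitely supported truncation of `ξ` is fixed by the projection onto the finitely many first
  -- coordinates that occur in it.
  have hfix : amplify e (∑ m ∈ W.image fun y => (e y).1, matrixUnit m m) ζ = ζ := by
    ext y
    by_cases hy : ∃ y' ∈ W, (e y').1 = (e y).1
    · rw [amplify_apply, sum_matrixUnit_apply, if_pos (by simpa using hy)]
      simp
    · have : ζ y = 0 := by
        rw [hζ, lp.coeFn_sum, Finset.sum_apply]
        refine Finset.sum_eq_zero fun y' hy' => ?_
        refine lp.single_apply_ne _ _ _ fun hyy => hy ⟨y', hy', by rw [hyy]⟩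
      rw [amplify_apply, sum_matrixUnit_apply, if_neg (by simpa using hy), this]
  have := (b * amplify e (∑ m ∈ W.image fun y => (e y).1, matrixUnit m m)).le_of_opNorm_le (h _) ζ
  rwa [mul_apply_eq_comp, hfix] at this

end MatrixUnit

end Amplification

/-! ### A contractive sum in a C*-algebra -/

/-- If the `v m` are contractions with mutually orthogonal ranges, then
`z ↦ ∑ m ∈ S, v m * z * star (v m)` is contractive. -/
lemma norm_sum_mul_mul_star_le {A ι : Type*} [CStarAlgebra A] (v : ι → A) (S : Finset ι)
    (hv : ∀ m, ‖v m‖ ≤ 1) (hP : ‖∑ m ∈ S, v m * star (v m)‖ ≤ 1)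
    (horth : ∀ m n, m ≠ n → star (v m) * v n = 0) (z : A) :
    ‖∑ m ∈ S, v m * z * star (v m)‖ ≤ ‖z‖ := by
  classical
  let _ : PartialOrder A := CStarAlgebra.spectralOrder A
  have _ : StarOrderedRing A := CStarAlgebra.spectralOrderedRing A
  set T := ∑ m ∈ S, v m * z * star (v m) with hT
  -- Orthogonality of the ranges kills the cross terms.
  have hTT : star T * T = ∑ m ∈ S, v m * (star z * (star (v m) * v m) * z) * star (v m) := by
    rw [hT, star_sum, Finset.sum_mul_sum]
    refine Finset.sum_congr rfl fun m hm => ?_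
    rw [Finset.sum_eq_single_of_mem m hm fun n _ hn => ?_]
    · simp only [star_mul, star_star, mul_assoc]
    · have := horth m n hn.symm
      calc _ = v m * star z * (star (v m) * v n) * z * star (v n) := by
            simp only [star_mul, star_star, mul_assoc]
        _ = 0 := by simp [this]
  -- Termwise `w h w* ≤ ‖h‖ w w*` for self-adjoint `h`; here `h = (v_m z)* (v_m z)` has norm at most
  -- `‖z‖²`.
  have hle : star T * T ≤ (‖z‖ * ‖z‖) • ∑ m ∈ S, v m * star (v m) := by
    rw [hTT, Finset.smul_sum]
    refine Finset.sum_le_sum fun m _ => ?_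
    have h0 : IsSelfAdjoint (star z * (star (v m) * v m) * z) := by
      simp [IsSelfAdjoint, mul_assoc]
    have h1 := CStarAlgebra.star_right_conjugate_le_norm_smul (a := v m) h0
    refine h1.trans (smul_le_smul_of_nonneg_right ?_ (mul_star_self_nonneg _))
    have : star z * (star (v m) * v m) * z = star (v m * z) * (v m * z) := by
      simp [mul_assoc]
    rw [this, CStarRing.norm_star_mul_self]
    have : ‖v m * z‖ ≤ ‖z‖ := (norm_mul_le _ _).trans
      (mul_le_of_le_one_left (norm_nonneg _) (hv m))
    gcongr
  have hn := CStarAlgebra.norm_le_norm_of_nonneg_of_le (star_mul_self_nonneg T) hle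
  rw [CStarRing.norm_star_mul_self, norm_smul] at hn
  refine le_of_sq_le_sq ?_ (norm_nonneg z)
  have : ‖(‖z‖ * ‖z‖)‖ = ‖z‖ * ‖z‖ := by simp
  nlinarith [mul_nonneg (norm_nonneg z) (norm_nonneg z)]

/-! ### Local operators inside the quasi-local algebra -/

namespace QuasiLocal

open Amplification CStarColimit

/-- The embedding of `B(ℓ²(ℕ)^{⊗ F})` into the quasi-local algebra. -/
def toLInf (F : Finset ℤ) : Op F →⋆ₐ[ℂ] LInf :=
  (of net netMap (hull F)).comp (incl (subset_hull F))

lemma of_incl {F : Finset ℤ} {I : Intvl} (h : F ⊆ I.1) (a : Op F) :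
    of net netMap I (incl h a) = toLInf F a := by
  obtain ⟨J, hJ, hJ'⟩ := exists_ge_ge I (hull F)
  change _ = of net netMap (hull F) (incl (subset_hull F) a)
  rw [← of_map net netMap I J hJ, ← of_map net netMap (hull F) J hJ',
    netMap, netMap, incl_incl, incl_incl]

lemma toLInf_intvl (I : Intvl) (a : Op I.1) : toLInf I.1 a = of net netMap I a := by
  rw [← of_incl (Finset.Subset.refl _), incl_self]

lemma toLInf_incl {F K : Finset ℤ} (h : F ⊆ K) (a : Op F) : toLInf K (incl h a) = toLInf F a := by
  rw [← of_incl (subset_hull K), incl_incl, of_incl]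

lemma norm_toLInf {F : Finset ℤ} (a : Op F) : ‖toLInf F a‖ = ‖a‖ :=
  (norm_of net netMap _ _).trans
    (NonUnitalStarAlgHom.norm_map (incl (subset_hull F)) (incl_injective _) a)

lemma toLInf_mem {F : Finset ℤ} (a : Op F) : toLInf F a ∈ localAlg F := ⟨a, rfl⟩

lemma isClosed_localAlg (F : Finset ℤ) : IsClosed (localAlg F : Set LInf) :=
  (AddMonoidHomClass.isometry_of_norm (toLInf F) norm_toLInf).isClosedEmbedding.isClosed_range

/-- Every element of the quasi-local algebra is approximated by elements supported on arbitrarily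
large finite sets. -/
lemma exists_norm_sub_toLInf_lt (x : LInf) (F : Finset ℤ) {ε : ℝ} (hε : 0 < ε) :
    ∃ K, F ⊆ K ∧ ∃ a : Op K, ‖x - toLInf K a‖ < ε := by
  obtain ⟨_, hy, hxy⟩ := (dense_iUnion_range_of net netMap).exists_dist_lt x hε
  obtain ⟨I, a, rfl⟩ := Set.mem_iUnion.1 hy
  refine ⟨F ∪ I.1, Finset.subset_union_left, incl Finset.subset_union_right a, ?_⟩
  rwa [toLInf_incl, toLInf_intvl, ← dist_eq_norm]

/-- The two splittings of `ℕ^K` have different types, as `K \ (K \ A)` equals `A` only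
propositionally; they induce the same amplification. -/
lemma incl_sdiff {A K : Finset ℤ} (h : A ⊆ K) (b : Op (K \ A)) :
    incl Finset.sdiff_subset b = amplify (flip (split h)) b := by
  ext ξ n
  have h1 : slice (split Finset.sdiff_subset) ξ (split (F := K \ A) Finset.sdiff_subset n).2 =
      slice (flip (split h)) ξ (flip (split h) n).2 := by
    ext m
    simp only [slice_apply]
    refine congrArg (ξ : (K → ℕ) → ℂ) (funext fun k => ?_)
    by_cases hk : (k : ℤ) ∈ A <;> simp [split, hk]
  simp only [incl, amplify_apply, h1]
  rfl

/-- Operators with disjoint supports commute. -/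
lemma commute_toLInf {A B : Finset ℤ} (h : Disjoint A B) (a : Op A) (b : Op B) :
    Commute (toLInf A a) (toLInf B b) := by
  have hA : A ⊆ A ∪ B := Finset.subset_union_left
  have hB : B ⊆ (A ∪ B) \ A := by
    rw [Finset.union_sdiff_cancel_left h]
  rw [← toLInf_incl hA, ← toLInf_incl hB, ← toLInf_incl (K := A ∪ B) Finset.sdiff_subset,
    incl_sdiff hA]
  exact (commute_amplify_flip _ _ _).map (toLInf (A ∪ B))

/-- The `P_S` tend to `1` strongly but in general not in norm, and an abstract element `z` acts on
no given Hilbert space. A local approximant does, so the operator statement is applied to it. -/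
lemma norm_le_of_forall_norm_mul_toLInf_le {B : Finset ℤ} (z : LInf) {C : ℝ}
    (h : ∀ S : Finset (B → ℕ), ‖z * toLInf B (∑ m ∈ S, matrixUnit m m)‖ ≤ C) : ‖z‖ ≤ C := by
  refine le_of_forall_pos_le_add fun ε hε => ?_
  -- One half of `ε` pays for bounding `‖b P_S‖` by `‖z P_S‖`, the other for returning from `‖b‖` to
  -- `‖z‖`.
  obtain ⟨K, hK, b, hb⟩ := exists_norm_sub_toLInf_lt z B (half_pos hε)
  have hbC : ‖b‖ ≤ C + ε / 2 := by
    refine norm_le_of_forall_norm_mul_le (split hK) b fun S => ?_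
    change ‖b * incl hK _‖ ≤ _
    rw [← norm_toLInf, map_mul, toLInf_incl]
    set P := toLInf B (∑ m ∈ S, matrixUnit m m) with hP
    have hP1 : ‖P‖ ≤ 1 := by
      rw [hP, norm_toLInf]
      exact (isStarProjection_sum_matrixUnit S).norm_le
    calc ‖toLInf K b * P‖ = ‖z * P - (z - toLInf K b) * P‖ := by
          congr 1; noncomm_ring
      _ ≤ ‖z * P‖ + ‖z - toLInf K b‖ * ‖P‖ :=
          (norm_sub_le _ _).trans (by gcongr; exact norm_mul_le _ _)
      _ ≤ C + ε / 2 := by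
          gcongr
          · exact h S
          · exact (mul_le_of_le_one_right (norm_nonneg _) hP1).trans hb.le
  rw [← norm_toLInf] at hbC
  have := norm_le_norm_add_norm_sub (toLInf K b) z
  rw [norm_sub_rev] at this
  linarith

/-! ### Shrinking the support of an approximant -/

/-- If `x` commutes with the local algebra of `K \ A`, then compressing an approximant supported on
`K` to `A` does not increase the distance to `x`. -/
lemma exists_norm_sub_toLInf_le {A K : Finset ℤ} (hA : A ⊆ K) {x : LInf}
    (hx : ∀ y ∈ localAlg (K \ A), Commute x y) (a : Op K) :
    ∃ a' : Op A, ‖x - toLInf A a'‖ ≤ ‖x - toLInf K a‖ := by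
  -- The reference configuration `0` is arbitrary; any fixed basis vector would serve.
  let v : (↥(K \ A) → ℕ) → LInf := fun m => toLInf (K \ A) (matrixUnit m 0)
  have hsv (m) : star (v m) = toLInf (K \ A) (matrixUnit 0 m) := by
    rw [← map_star, star_matrixUnit]
  have hvv (m) : v m * star (v m) = toLInf (K \ A) (matrixUnit m m) := by
    rw [hsv, ← map_mul, matrixUnit_mul, if_pos rfl]
  have hsum (S) : ∑ m ∈ S, v m * star (v m) = toLInf (K \ A) (∑ m ∈ S, matrixUnit m m) := by
    simp_rw [hvv, map_sum]
  have hle (S : Finset (↥(K \ A) → ℕ)) : ‖∑ m ∈ S, v m * star (v m)‖ ≤ 1 := by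
    rw [hsum, norm_toLInf]
    exact (isStarProjection_sum_matrixUnit S).norm_le
  have hv (m) : ‖v m‖ ≤ 1 := by
    have := hle {m}
    rw [Finset.sum_singleton, CStarRing.norm_self_mul_star] at this
    nlinarith [norm_nonneg (v m)]
  have horth (m n) (hmn : m ≠ n) : star (v m) * v n = 0 := by
    rw [hsv, ← map_mul, matrixUnit_mul, if_neg hmn, map_zero]
  have hcomp (m) : v m * toLInf K a * star (v m) =
      toLInf A (compress (split hA) 0 a) * (v m * star (v m)) := by
    rw [hvv, hsv, show v m = toLInf (K \ A) (matrixUnit m 0) from rfl,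
      ← toLInf_incl (K := K) Finset.sdiff_subset (matrixUnit m 0),
      ← toLInf_incl (K := K) Finset.sdiff_subset (matrixUnit 0 m),
      ← toLInf_incl (K := K) Finset.sdiff_subset (matrixUnit m m), ← toLInf_incl hA,
      ← map_mul, ← map_mul, ← map_mul, incl_sdiff hA, incl_sdiff hA, incl_sdiff hA,
      matrixUnit_mul_mul_matrixUnit, incl]
  have hxv (m) : v m * x * star (v m) = x * (v m * star (v m)) := by
    rw [← (hx (v m) (toLInf_mem _)).eq, mul_assoc]
  refine ⟨compress (split hA) 0 a, norm_le_of_forall_norm_mul_toLInf_le (B := K \ A) _ fun S => ?_⟩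
  -- The equality is `(x - E(a)) P_S = ∑_{m ∈ S} v_m (x - a) v_m*`.
  refine le_of_eq_of_le (congrArg _ ?_) (norm_sum_mul_mul_star_le v S hv (hle S) horth _)
  simp_rw [mul_sub, sub_mul, hcomp, hxv, Finset.sum_sub_distrib, ← Finset.mul_sum, hsum]

/-- If `x` commutes with all single-site algebras outside `F`, then any approximant of `x` can be
replaced by one supported on `F`. -/
lemma exists_norm_sub_toLInf_le_of_forall_singleton {F : Finset ℤ} {x : LInf}
    (hx : ∀ k ∉ F, ∀ y ∈ localAlg {k}, Commute x y) {K : Finset ℤ} (hF : F ⊆ K) (a : Op K) :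
    ∃ a' : Op F, ‖x - toLInf F a'‖ ≤ ‖x - toLInf K a‖ := by
  induction K using Finset.strongInduction with
  | H K ih =>
    rcases hF.eq_or_ssubset with rfl | hss
    · exact ⟨a, le_rfl⟩
    · obtain ⟨k, hkK, hkF⟩ := Finset.exists_of_ssubset hss
      have hk : K \ K.erase k = {k} := by
        simp [Finset.sdiff_erase_self hkK]
      obtain ⟨b, hb⟩ := exists_norm_sub_toLInf_le (K.erase_subset k)
        (by rw [hk]; exact hx k hkF) a
      obtain ⟨c, hc⟩ := ih _ (Finset.erase_ssubset hkK)
        (Finset.subset_erase.2 ⟨hF, hkF⟩) b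
      exact ⟨c, hc.trans hb⟩

/-! ### Commutation with the complement -/

/-- Elements of the local algebra of `F` commute with the algebra of the complement of `F`. -/
lemma commute_of_mem_localAlg_of_mem_regionAlg {F : Finset ℤ} {x y : LInf} (hx : x ∈ localAlg F)
    (hy : y ∈ regionAlg ((F : Set ℤ)ᶜ)) : Commute x y := by
  obtain ⟨a, rfl⟩ := hx
  have hclosed : IsClosed {y : LInf | Commute (toLInf F a) y} :=
    isClosed_eq (continuous_const.mul continuous_id) (continuous_id.mul continuous_const)
  refine closure_minimal (fun y hy => ?_) hclosed hy
  -- The centralizer of the whole range is used rather than that of one operator: the range is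
  -- closed under `star`, so commuting with `c` and `star c` is the same kind of condition.
  suffices StarAlgebra.adjoin ℂ (⋃ (I : Intvl) (_ : (I.1 : Set ℤ) ⊆ (F : Set ℤ)ᶜ),
      (localAlg I.1 : Set LInf)) ≤
      StarSubalgebra.centralizer ℂ (Set.range (toLInf F)) from
    (StarSubalgebra.mem_centralizer_iff ℂ).1 (this hy) _ ⟨a, rfl⟩ |>.1
  refine StarAlgebra.adjoin_le fun y hy => ?_
  simp only [Set.mem_iUnion] at hy
  obtain ⟨I, hI, b, rfl⟩ := hy
  have hd : Disjoint F I.1 :=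
    Finset.disjoint_right.2 fun k hk => by simpa using hI hk
  refine (StarSubalgebra.mem_centralizer_iff ℂ).2 ?_
  rintro _ ⟨c, rfl⟩
  rw [← map_star]
  exact ⟨commute_toLInf hd c b, commute_toLInf hd (star c) b⟩

lemma localAlg_singleton_le_regionAlg {S : Set ℤ} {k : ℤ} (hk : k ∈ S) :
    localAlg {k} ≤ regionAlg S := by
  intro y hy
  refine StarSubalgebra.le_topologicalClosure _ (StarAlgebra.subset_adjoin ℂ _ ?_)
  refine Set.mem_iUnion₂.2 ⟨⟨{k}, ?_⟩, ?_, hy⟩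
  · simp [Set.ordConnected_singleton]
  · simpa using hk

end QuasiLocal

end

theorem mainTheorem7 (F : Finset ℤ) :
    {x : QuasiLocal.LInf | ∀ y ∈ QuasiLocal.regionAlg ((F : Set ℤ)ᶜ), x * y - y * x = 0} =
      (QuasiLocal.localAlg F : Set QuasiLocal.LInf) := by
  ext x
  refine ⟨fun hx => ?_, fun hx y hy =>
    sub_eq_zero.2 (QuasiLocal.commute_of_mem_localAlg_of_mem_regionAlg hx hy)⟩
  rw [← (QuasiLocal.isClosed_localAlg F).closure_eq]
  refine Metric.mem_closure_iff.2 fun ε hε => ?_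
  obtain ⟨K, hK, a, ha⟩ := QuasiLocal.exists_norm_sub_toLInf_lt x F hε
  obtain ⟨b, hb⟩ := QuasiLocal.exists_norm_sub_toLInf_le_of_forall_singleton (x := x)
    (fun k hk y hy => sub_eq_zero.1 (hx y
      (QuasiLocal.localAlg_singleton_le_regionAlg (by simpa using hk) hy))) hK a
  exact ⟨_, QuasiLocal.toLInf_mem b, by rw [dist_eq_norm]; exact hb.trans_lt ha⟩
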